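/- **Proposition 1.14.** Let $K$ be an infinite field, let $E=K((X,Y))=\mathrm{Quot}(K[[X,Y]])$, and let $v$ be the discrete valuation of $E$ extending the order function of the maximal ideal $\langle X,Y\rangle$ of $K[[X,Y]]$. Let $\hat E$ be the completion of $E$ with respect to $v$. Let $I$ be a finite set and let $c_i\in K$ ($i\in I$) be pairwise distinct. For $i\in I$ put $z_i=\frac{Y}{X-c_iY}\in E$. For $J\subseteq I$ let $D_J\subseteq\hat E$ be the completion (that is, the closure in $\hat E$) of the subring $K[z_j\mid j\in J][X,Y]$ of $E$ with respect to $v$. Let $Q=\mathrm{Quot}(D_I)\subseteq\hat E$. For $i\in I$ let $Q_i=E\cdot D_{I\smallsetminus\{i\}}$ be the subring of $\hat E$ generated by $E$ and $D_{I\smallsetminus\{i\}}$, and let $Q_i'=\bigcap_{j\in I,\,j\neq i}Q_j$, the intersection being taken inside $Q$ (so that $Q_i'=Q$ if $I=\{i\}$). Then for each $i\in I$, each $n\in\mathbb N$ and each $b\in\mathrm{GL}_n(Q)$ there exist $b_1\in\mathrm{GL}_n(Q_i)$ and $b_2\in\mathrm{GL}_n(Q_i')$ such that $b=b_1b_2$.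 -/

import Mathlib

open scoped WithZero

noncomputable section

namespace AnalyticPatching

variable (K : Type*) [Field K]

/-- The ring `K[[X, Y]]` of formal power series in two variables. -/
abbrev PS : Type _ := MvPowerSeries (Fin 2) K

/-- The field `E = K((X, Y)) = Quot(K[[X, Y]])`. -/
abbrev E : Type _ := FractionRing (PS K)

/-- The order function of the maximal ideal `⟨X, Y⟩` of `K[[X, Y]]`, written multiplicatively: a
nonzero power series whose nonzero homogeneous component of lowest degree has degree `m` (that is,
which lies in `⟨X, Y⟩ ^ m` but not in `⟨X, Y⟩ ^ (m + 1)`) is sent to `exp (-m)`, and `0` is sent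
to `0`. -/
def orderValuation : Valuation (PS K) ℤᵐ⁰ := by
  classical
  exact
  { toFun := fun f => if f = 0 then 0 else WithZero.exp (-(f.order.toNat : ℤ))
    map_zero' := if_pos rfl
    map_one' := by
      have h : (1 : PS K).order = 0 := by
        have := MvPowerSeries.order_monomial_of_ne_zero (σ := Fin 2) (R := K) (d := 0)
          (a := (1 : K)) one_ne_zero
        simpa using this
      rw [if_neg one_ne_zero, h]
      simp
    map_mul' := fun f g => by
      by_cases hf : f = 0
      · simp [hf]
      by_cases hg : g = 0
      · simp [hg]
      have hf' : f.order ≠ ⊤ := fun h => hf (MvPowerSeries.order_eq_top_iff.1 h)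
      have hg' : g.order ≠ ⊤ := fun h => hg (MvPowerSeries.order_eq_top_iff.1 h)
      rw [if_neg (mul_ne_zero hf hg), if_neg hf, if_neg hg, MvPowerSeries.order_mul,
        ENat.toNat_add hf' hg', ← WithZero.exp_add]
      congr 1
      push_cast
      ring
    map_add_le_max' := fun f g => by
      by_cases hf : f = 0
      · simp [hf]
      by_cases hg : g = 0
      · simp [hg]
      by_cases hfg : f + g = 0
      · simp [hfg]
      have hfg' : (f + g).order ≠ ⊤ := fun h => hfg (MvPowerSeries.order_eq_top_iff.1 h)
      rw [if_neg hfg, if_neg hf, if_neg hg, le_max_iff]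
      have h := MvPowerSeries.min_order_le_add (f := f) (g := g)
      rcases min_le_iff.1 h with h | h
      · left
        have := ENat.toNat_le_toNat h hfg'
        rw [WithZero.exp_le_exp]
        omega
      · right
        have := ENat.toNat_le_toNat h hfg'
        rw [WithZero.exp_le_exp]
        omega }

theorem orderValuation_apply_of_ne_zero {f : PS K} (hf : f ≠ 0) :
    orderValuation K f = WithZero.exp (-(f.order.toNat : ℤ)) := by
  classical
  exact if_neg hf

theorem nonZeroDivisors_le_primeCompl :
    nonZeroDivisors (PS K) ≤ (orderValuation K).supp.primeCompl := by
  intro f hf h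
  rw [SetLike.mem_coe, Valuation.mem_supp_iff,
    orderValuation_apply_of_ne_zero K (nonZeroDivisors.ne_zero hf)] at h
  exact WithZero.exp_ne_zero h

/-- The discrete valuation `v` of `E` extending the order function of `K[[X, Y]]`. -/
def v : Valuation (E K) ℤᵐ⁰ :=
  (orderValuation K).extendToLocalization (nonZeroDivisors_le_primeCompl K) (E K)

/-- The completion of the field `E` with respect to `v`. All the rings below are subrings of this
field. -/
abbrev EHat : Type _ := (v K).Completion

/-- The canonical embedding of `E` in its completion. -/
def toEHat : E K →+* EHat K :=
  (UniformSpace.Completion.coeRingHom : WithVal (v K) →+* EHat K).comp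
    ((WithVal.equiv (v K)).symm : E K →+* WithVal (v K))

/-- The element `X` of `E`. -/
def X : E K := algebraMap (PS K) (E K) (MvPowerSeries.X 0)

/-- The element `Y` of `E`. -/
def Y : E K := algebraMap (PS K) (E K) (MvPowerSeries.X 1)

variable {K} {I : Type*} (c : I → K)

/-- The element `z_i = Y / (X - c_i Y)` of `E`. -/
def z (i : I) : E K := Y K / (X K - algebraMap K (E K) (c i) * Y K)

/-- The subring `K[z_j | j ∈ J][X, Y]` of `E`. -/
def polyRing (J : Set I) : Subalgebra K (E K) :=
  Algebra.adjoin K (z c '' J ∪ {X K, Y K})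

/-- The ring `D_J`: the completion of `K[z_j | j ∈ J][X, Y]` with respect to `v`, realized as its
closure in the completion of `E`. -/
def D (J : Set I) : Subring (EHat K) :=
  ((polyRing c J).toSubring.map (toEHat K)).topologicalClosure

/-- The field `Q = Quot(D_I)`, that is, the field of all quotients of elements of `D_I`. -/
def Q : Subfield (EHat K) := Subfield.closure (D c Set.univ : Set (EHat K))

/-- The ring `Q_i = E ⬝ D_{I ∖ {i}}`: the subring generated by `E` and `D_{I ∖ {i}}`. -/
def Qi (i : I) : Subring (EHat K) := (toEHat K).range ⊔ D c {i}ᶜ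

/-- The ring `Q'_i`: the intersection, inside `Q`, of the rings `Q_j` for `j ≠ i`. If there is no
such `j` it is `Q`. -/
def Qi' (i : I) : Subring (EHat K) := (Q c).toSubring ⊓ ⨅ j ∈ ({i}ᶜ : Set I), Qi c j

end AnalyticPatching

end

/-!
Fix `i` and let `T = X - c_i Y`. In the fraction `t = X / Y` we have `z_j = 1 / (t - c_j)`, and
`Y = z_i T`. Nonzero elements of `R_J = K[z_j | j ∈ J]` have valuation `0`, so for every `J` the
power series in `T` over `R_J` form a subring of the completion, contained in `D_J` and closed; for
`J = I` it is all of `D_I`. Two facts give the factorization.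

* `R_I` modulo a nonzero element is finite over `K`, so modulo any `δ ≠ 0` a power series over `R_I`
  is congruent to an `R_I`-combination of power series in `T` over `K`, hence to an element of `E`.
  Multiplication by a matrix over `E` therefore reduces `b` to a matrix over `R_I[[T]]` that is the
  identity modulo `T`.
* By partial fractions, `R_I` is the sum of `R_{I ∖ {i}}` and `R_{i}`. Solving for the coefficients
  one after the other (Cartan's lemma), a matrix over `R_I[[T]]` that is the identity modulo `T` is
  the product of invertible ones over `R_{I ∖ {i}}[[T]]` and over `R_{i}[[T]]`.
-/

noncomputable section

namespace Patching

open PowerSeries Finset Filter Topology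
open scoped IntermediateField

section Recursion

theorem exists_forall_sub_antidiagonal_sum_mem {M : Type*} [Ring M] (g : ℕ → M) {A V : Set M}
    (h : ∀ m, ∃ q ∈ A, m - q * g 0 ∈ V) (f : ℕ → M) :
    ∃ q : ℕ → M, (∀ n, q n ∈ A) ∧ ∀ n, f n - ∑ x ∈ antidiagonal n, q x.1 * g x.2 ∈ V := by
  choose r hrA hrV using h
  let q : ℕ → M := Nat.strongRec fun n q' => r (f n - ∑ k : Fin n, q' k k.2 * g (n - k))
  have hq (n) : q n = r (f n - ∑ k ∈ range n, q k * g (n - k)) := by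
    rw [← Fin.sum_univ_eq_sum_range (fun k => q k * g (n - k))]
    exact Nat.strongRec_eq ..
  refine ⟨q, fun n => hq n ▸ hrA _, fun n => ?_⟩
  rw [Nat.sum_antidiagonal_eq_sum_range_succ_mk, sum_range_succ, Nat.sub_self, ← sub_sub]
  have := hrV (f n - ∑ k ∈ range n, q k * g (n - k))
  rwa [← hq] at this

end Recursion

section Cartan

variable {ι R R₁ R₂ : Type*} [CommRing R] [CommRing R₁] [CommRing R₂]

/-- The matrix of power series `∑ Aₙ Xⁿ` with coefficient matrices `Aₙ`. -/
def seriesMatrix (A : ℕ → Matrix ι ι R) : Matrix ι ι R⟦X⟧ :=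
  .of fun a b => PowerSeries.mk fun n => A n a b

@[simp]
theorem map_coeff_seriesMatrix (A : ℕ → Matrix ι ι R) (n : ℕ) :
    (seriesMatrix A).map (coeff n) = A n := by
  ext
  simp [seriesMatrix]

theorem map_seriesMatrix (φ : R₁ →+* R) (A : ℕ → Matrix ι ι R₁) :
    (seriesMatrix A).map (PowerSeries.map φ) = seriesMatrix fun n => (A n).map φ := by
  ext
  simp [seriesMatrix]

theorem matrix_ext_coeff {P Q : Matrix ι ι R⟦X⟧}
    (h : ∀ n, P.map (coeff n) = Q.map (coeff n)) : P = Q := by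
  ext a b n
  exact congr_fun₂ (h n) a b

theorem map_coeff_mul [Fintype ι] (P Q : Matrix ι ι R⟦X⟧) (n : ℕ) :
    (P * Q).map (coeff n) = ∑ x ∈ antidiagonal n, P.map (coeff x.1) * Q.map (coeff x.2) := by
  ext a b
  simp only [Matrix.map_apply, Matrix.mul_apply, map_sum, coeff_mul, Matrix.sum_apply]
  exact sum_comm

variable [DecidableEq ι]

theorem eq_one_add_X_smul {H : Matrix ι ι R⟦X⟧} (hH : H.map constantCoeff = 1) :
    H = 1 + (X : R⟦X⟧) • seriesMatrix fun n => H.map (coeff (n + 1)) := by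
  ext a b n
  have h0 := congr_fun₂ hH a b
  cases n with
  | zero => rcases eq_or_ne a b with rfl | hab <;> simp_all [seriesMatrix]
  | succ n => simp [seriesMatrix, Matrix.one_apply, apply_ite, coeff_one, coeff_succ_X_mul]

theorem map_constantCoeff_one_add_X_smul (A : Matrix ι ι R⟦X⟧) :
    (1 + (X : R⟦X⟧) • A).map constantCoeff = 1 := by
  ext a b
  rcases eq_or_ne a b with rfl | hab <;> simp_all

theorem map_one_add_X_smul (φ : R₁ →+* R) (A : Matrix ι ι R₁⟦X⟧) :
    (1 + (X : R₁⟦X⟧) • A).map (PowerSeries.map φ) =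
      1 + (X : R⟦X⟧) • A.map (PowerSeries.map φ) := by
  ext a b : 1
  rcases eq_or_ne a b with rfl | hab <;> simp_all

variable [Fintype ι]

theorem isUnit_of_isUnit_map (f : R₁ →+* R) [IsLocalHom f] {A : Matrix ι ι R₁}
    (hA : IsUnit (A.map f)) : IsUnit A := by
  rw [← RingHom.mapMatrix_apply, Matrix.isUnit_iff_isUnit_det, ← RingHom.map_det] at hA
  exact (Matrix.isUnit_iff_isUnit_det A).2 (isUnit_of_map_unit f _ hA)

instance isLocalHom_constantCoeff : IsLocalHom (constantCoeff (R := R)) :=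
  ⟨fun _ => isUnit_iff_constantCoeff.2⟩

theorem exists_GL_eq_one_add_X_smul (A : Matrix ι ι R⟦X⟧) :
    ∃ P : GL ι R⟦X⟧, P.map constantCoeff = 1 ∧ P.val = 1 + (X : R⟦X⟧) • A := by
  have h1 := map_constantCoeff_one_add_X_smul A
  obtain ⟨P, hP⟩ := isUnit_of_isUnit_map (A := 1 + (X : R⟦X⟧) • A) constantCoeff (h1 ▸ isUnit_one)
  exact ⟨P, Units.ext (show P.val.map constantCoeff = 1 by rw [hP, h1]), hP⟩

theorem exists_map_mul_add_map_eq {φ₁ : R₁ →+* R} {φ₂ : R₂ →+* R}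
    (h : ∀ x, ∃ x₁ x₂, φ₁ x₁ + φ₂ x₂ = x) {H : Matrix ι ι R⟦X⟧} (hH : H.map constantCoeff = 1)
    (F : Matrix ι ι R⟦X⟧) :
    ∃ (A : Matrix ι ι R₁⟦X⟧) (B : Matrix ι ι R₂⟦X⟧),
      A.map (PowerSeries.map φ₁) * H + B.map (PowerSeries.map φ₂) = F := by
  have split (M : Matrix ι ι R) : ∃ A ∈ Set.range fun A : Matrix ι ι R₁ => A.map φ₁,
      M - A * H.map (coeff 0) ∈ Set.range fun B : Matrix ι ι R₂ => B.map φ₂ := by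
    choose x₁ x₂ hx using fun a b => h (M a b)
    refine ⟨_, ⟨.of x₁, rfl⟩, .of x₂, ?_⟩
    rw [coeff_zero_eq_constantCoeff, hH, mul_one]
    ext a b
    simp [← hx]
  obtain ⟨A, hA, hB⟩ := exists_forall_sub_antidiagonal_sum_mem
    (fun n => H.map (coeff n)) split fun n => F.map (coeff n)
  choose A₁ hA₁ using hA
  choose B₂ hB₂ using hB
  obtain rfl : (fun n => (A₁ n).map φ₁) = A := funext hA₁
  refine ⟨seriesMatrix A₁, seriesMatrix B₂, ?_⟩
  rw [← eq_sub_iff_add_eq']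
  refine matrix_ext_coeff fun n => ?_
  simp only [map_seriesMatrix, map_coeff_seriesMatrix, map_coeff_mul,
    Matrix.map_sub _ (map_sub (coeff n))]
  exact hB₂ n

theorem exists_eq_map_mul_map {φ₁ : R₁ →+* R} {φ₂ : R₂ →+* R}
    (h : ∀ x, ∃ x₁ x₂, φ₁ x₁ + φ₂ x₂ = x) {H : GL ι R⟦X⟧} (hH : H.map constantCoeff = 1) :
    ∃ (P₁ : GL ι R₁⟦X⟧) (P₂ : GL ι R₂⟦X⟧),
      H = P₁.map (PowerSeries.map φ₁) * P₂.map (PowerSeries.map φ₂) := by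
  replace hH : H.val.map constantCoeff = 1 := congr_arg Units.val hH
  obtain ⟨A, B, hAB⟩ :=
    exists_map_mul_add_map_eq h hH (seriesMatrix fun n => H.val.map (coeff (n + 1)))
  obtain ⟨P₁, -, hP₁⟩ := exists_GL_eq_one_add_X_smul (-A)
  obtain ⟨P₂, -, hP₂⟩ := exists_GL_eq_one_add_X_smul B
  refine ⟨P₁⁻¹, P₂, ?_⟩
  rw [map_inv, eq_inv_mul_iff_mul_eq, Units.ext_iff, Units.val_mul]
  change P₁.val.map _ * _ = P₂.val.map _
  calc P₁.val.map (PowerSeries.map φ₁) * H.val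
    _ = H.val - (X : R⟦X⟧) • (A.map (PowerSeries.map φ₁) * H.val) := by
      rw [hP₁, map_one_add_X_smul, Matrix.map_neg _ (map_neg _), smul_neg, ← sub_eq_add_neg,
        sub_mul, one_mul, Matrix.smul_mul]
    _ = 1 + (X : R⟦X⟧) • B.map (PowerSeries.map φ₂) := by
      nth_rw 1 [eq_one_add_X_smul hH]
      rw [← hAB, smul_add]
      abel
    _ = P₂.val.map (PowerSeries.map φ₂) := by rw [hP₂, map_one_add_X_smul]

end Cartan

section Division

variable {K R : Type*} [CommRing K] [CommRing R] [Algebra K R]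

theorem exists_span_range_forall_exists_sub_mul_mem (d : R)
    [Module.Finite K (R ⧸ Ideal.span {d})] :
    ∃ (n : ℕ) (w : Fin n → R), ∀ x, ∃ q, x - q * d ∈ Submodule.span K (Set.range w) := by
  obtain ⟨n, w, hw⟩ := Module.Finite.exists_fin (R := K) (M := R ⧸ Ideal.span {d})
  choose w' hw' using fun i => Ideal.Quotient.mk_surjective (w i)
  refine ⟨n, w', fun x => ?_⟩
  have hx : Ideal.Quotient.mk (Ideal.span {d}) x ∈ Submodule.span K (Set.range w) :=
    hw ▸ Submodule.mem_top
  obtain ⟨a, ha⟩ := (Submodule.mem_span_range_iff_exists_fun K).1 hx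
  have : x - ∑ i, a i • w' i ∈ Ideal.span {d} := by
    rw [← Ideal.Quotient.eq, ← ha, ← Ideal.Quotient.mkₐ_eq_mk K, map_sum]
    simp [hw']
  obtain ⟨q, hq⟩ := Ideal.mem_span_singleton'.1 this
  refine ⟨q, (Submodule.mem_span_range_iff_exists_fun K).2 ⟨a, ?_⟩⟩
  rw [hq, sub_sub_cancel]

variable {S : Subring R⟦X⟧}

theorem mem_of_forall_coeff_mem_span (hC : ∀ r, C r ∈ S)
    (hS : ∀ h : K⟦X⟧, h.map (algebraMap K R) ∈ S) {n : ℕ} {w : Fin n → R} {f : R⟦X⟧}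
    (hf : ∀ k, coeff k f ∈ Submodule.span K (Set.range w)) : f ∈ S := by
  choose a ha using fun k => (Submodule.mem_span_range_iff_exists_fun K).1 (hf k)
  have : f = ∑ i, C (w i) * (PowerSeries.mk fun k => a k i).map (algebraMap K R) := by
    ext k
    simp [← ha, Algebra.smul_def, mul_comm]
  rw [this]
  exact sum_mem fun i _ => S.mul_mem (hC _) (hS _)

theorem exists_sub_mul_mem (hC : ∀ r, C r ∈ S) (hS : ∀ h : K⟦X⟧, h.map (algebraMap K R) ∈ S)
    (hR : ∀ d : R, d ≠ 0 → Module.Finite K (R ⧸ Ideal.span {d})) {δ : R⟦X⟧} (hδ : δ ≠ 0)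
    (f : R⟦X⟧) : ∃ g, f - g * δ ∈ S := by
  obtain ⟨k, d, hd, rfl⟩ : ∃ (k : ℕ) (d : R⟦X⟧), constantCoeff d ≠ 0 ∧ X ^ k * d = δ :=
    ⟨_, δ.divXPowOrder, mt constantCoeff_divXPowOrder_eq_zero_iff.1 hδ,
      X_pow_order_mul_divXPowOrder⟩
  have := hR _ hd
  obtain ⟨n, w, hw⟩ := exists_span_range_forall_exists_sub_mul_mem (K := K) (constantCoeff d)
  obtain ⟨q, -, hq⟩ := exists_forall_sub_antidiagonal_sum_mem (fun j => coeff j d)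
    (A := Set.univ) (V := Submodule.span K (Set.range w)) (by simpa using hw)
    fun j => coeff (j + k) f
  have htrunc : (trunc k f : R⟦X⟧) ∈ S := by
    refine mem_of_forall_coeff_mem_span (w := fun j : Fin k => coeff j f) hC hS fun j => ?_
    rw [Polynomial.coeff_coe, coeff_trunc]
    split_ifs with hj
    · exact Submodule.subset_span ⟨⟨j, hj⟩, rfl⟩
    · exact zero_mem _
  have hrem : (PowerSeries.mk fun j => coeff (j + k) f) - PowerSeries.mk q * d ∈ S := by
    refine mem_of_forall_coeff_mem_span (w := w) hC hS fun j => ?_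
    simpa [coeff_mul] using hq j
  have hX : X ^ k ∈ S := S.pow_mem (by simpa using hS X) k
  refine ⟨PowerSeries.mk q, ?_⟩
  convert S.add_mem (S.mul_mem hX hrem) htrunc using 1
  nth_rw 1 [eq_X_pow_mul_shift_add_trunc k f]
  ring

end Division

section Decomposition

theorem exists_mul_eq_map_of_forall_mem_closure {A F κ : Type*} [CommRing A] [Field F]
    [Finite κ] {φ : A →+* F} {x : κ → F} (hx : ∀ k, x k ∈ Subfield.closure (Set.range φ)) :
    ∃ (d : A) (a : κ → A), φ d ≠ 0 ∧ ∀ k, φ d * x k = φ (a k) := by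
  classical
  cases nonempty_fintype κ
  have hx' (k) : ∃ p q : A, φ q ≠ 0 ∧ φ q * x k = φ p := by
    obtain ⟨y, hy, w, hw, h⟩ := Subfield.mem_closure_iff.1 (hx k)
    rw [← RingHom.coe_range, Subring.closure_eq] at hy hw
    obtain ⟨⟨p, rfl⟩, ⟨q, rfl⟩⟩ := And.intro hy hw
    by_cases hq : φ q = 0
    · exact ⟨0, 1, by simp, by simp [← h, hq]⟩
    · exact ⟨p, q, hq, by rw [← h, mul_div_cancel₀ _ hq]⟩
  choose p q hq hpq using hx'
  refine ⟨∏ k, q k, fun k => (∏ l ∈ univ.erase k, q l) * p k, ?_, fun k => ?_⟩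
  · rw [map_prod]
    exact prod_ne_zero_iff.2 fun k _ => hq k
  · rw [← prod_erase_mul univ q (mem_univ k), map_mul, mul_assoc, hpq, map_mul]

variable {R E F ι : Type*} [CommRing R] [Field E] [Field F] [Fintype ι] [DecidableEq ι]
  {φ : R⟦X⟧ →+* F} {ε : E →+* F}

theorem X_mul_ne_zero {d : R⟦X⟧} (hd : d ≠ 0) : X * d ≠ 0 :=
  fun h => hd (X_mul_cancel (h.trans (mul_zero X).symm))

theorem exists_map_mul_mem_range (h : ∀ δ ≠ 0, ∀ f, ∃ g, φ (f - g * δ) ∈ ε.range) (d : R⟦X⟧) :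
    ∃ u, constantCoeff u = 1 ∧ φ (d * u) ∈ ε.range := by
  rcases eq_or_ne d 0 with rfl | hd
  · exact ⟨1, by simp⟩
  obtain ⟨g, hg⟩ := h (X * d) (X_mul_ne_zero hd) d
  exact ⟨1 - X * g, by simp, by convert hg using 2; ring⟩

theorem exists_map_mul_eq_map (h : ∀ δ ≠ 0, ∀ f, ∃ g, φ (f - g * δ) ∈ ε.range)
    {B : Matrix ι ι R⟦X⟧} (hB : B.det ≠ 0) :
    ∃ (G : GL ι R⟦X⟧) (A : Matrix ι ι E),
      G.map constantCoeff = 1 ∧ (B * G.val).map φ = A.map ε := by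
  choose g A hA using fun a b => h (X * B.det) (X_mul_ne_zero hB) (B a b)
  -- Since `B * adj B = det B`, multiplying `B` by `1 - X adj(B) g` gives `B - X det(B) g`.
  obtain ⟨G, hG1, hG⟩ := exists_GL_eq_one_add_X_smul (-(B.adjugate * .of g))
  refine ⟨G, .of A, hG1, ?_⟩
  rw [hG, mul_add, mul_one, Matrix.mul_smul, mul_neg, ← mul_assoc, Matrix.mul_adjugate]
  ext a b
  simp only [Matrix.smul_mul, one_mul, Matrix.map_apply, Matrix.add_apply, Matrix.smul_apply,
    Matrix.neg_apply, Matrix.of_apply, smul_eq_mul, hA]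
  congr 1
  ring

theorem exists_eq_map_mul_map_of_forall_mem_closure
    (h : ∀ δ ≠ 0, ∀ f, ∃ g, φ (f - g * δ) ∈ ε.range) {b : GL ι F}
    (hb : ∀ k l, b k l ∈ Subfield.closure (Set.range φ)) :
    ∃ (x : GL ι E) (H : GL ι R⟦X⟧), H.map constantCoeff = 1 ∧ b = x.map ε * H.map φ := by
  obtain ⟨d, a, hd, hda⟩ := exists_mul_eq_map_of_forall_mem_closure (φ := φ)
    (x := fun k : ι × ι => b k.1 k.2) fun k => hb k.1 k.2
  obtain ⟨u, hu, e, he⟩ := exists_map_mul_mem_range h d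
  have he0 : ε e ≠ 0 := by
    rw [he, map_mul]
    exact mul_ne_zero hd ((isUnit_iff_constantCoeff.2 (hu ▸ isUnit_one)).map φ).ne_zero
  let B : Matrix ι ι R⟦X⟧ := .of fun k l => a (k, l) * u
  have hB : B.map φ = ε e • b.val := by
    ext k l
    simp only [B, Matrix.map_apply, Matrix.of_apply, Matrix.smul_apply, smul_eq_mul, map_mul,
      ← hda, he]
    ring
  have hBu : IsUnit (B.map φ) := hB ▸ b.isUnit.smul (Units.mk0 _ he0)
  have hdet : B.det ≠ 0 := fun h0 => by
    rw [← RingHom.mapMatrix_apply, Matrix.isUnit_iff_isUnit_det, ← RingHom.map_det, h0, map_zero]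
      at hBu
    exact not_isUnit_zero hBu
  obtain ⟨G, A, hG, hA⟩ := exists_map_mul_eq_map h hdet
  have hx : (e⁻¹ • A).map ε = (b * G.map φ).val := by
    calc (e⁻¹ • A).map ε = (ε e)⁻¹ • A.map ε := by ext; simp
      _ = b.val * G.val.map φ := by
        rw [← hA, Matrix.map_mul, hB, Matrix.smul_mul, inv_smul_smul₀ he0]
  obtain ⟨x, hxA⟩ := isUnit_of_isUnit_map ε (hx ▸ (b * G.map φ).isUnit)
  refine ⟨x, G⁻¹, by rw [map_inv, hG, inv_one], ?_⟩
  rw [map_inv]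
  exact eq_mul_inv_of_mul_eq (Units.ext (by rw [← hx, ← hxA]; rfl))

end Decomposition

section PoleRing

section Adjoin

variable {K A : Type*} [CommRing K] [CommRing A] [Algebra K A] {S T : Set A}

theorem mul_mem_span_sup_adjoin {x : A}
    (h : ∀ y ∈ T, x * y ∈ Submodule.span K {x} ⊔ Submodule.span K {y}) {u : A}
    (hu : u ∈ Algebra.adjoin K T) :
    x * u ∈ Submodule.span K {x} ⊔ (Algebra.adjoin K T).toSubmodule := by
  induction hu using Algebra.adjoin_induction with
  | mem y hy =>
    have hyT : Submodule.span K {y} ≤ (Algebra.adjoin K T).toSubmodule :=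
      (Submodule.span_singleton_le_iff_mem _ _).2 (Algebra.subset_adjoin hy)
    exact (sup_le_sup_left hyT (Submodule.span K {x}) :) (h y hy)
  | algebraMap r =>
    rw [mul_comm, ← Algebra.smul_def]
    exact Submodule.mem_sup_left (Submodule.smul_mem _ r (Submodule.mem_span_singleton_self x))
  | add u v _ _ hu hv =>
    rw [mul_add]
    exact add_mem hu hv
  | mul u v _ hv hu hv' =>
    obtain ⟨y, hy, w, hw, hyw⟩ := Submodule.mem_sup.1 hu
    obtain ⟨k, rfl⟩ := Submodule.mem_span_singleton.1 hy
    rw [← mul_assoc, ← hyw, add_mul, smul_mul_assoc]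
    exact add_mem (Submodule.smul_mem _ k hv')
      (Submodule.mem_sup_right ((Algebra.adjoin K T).mul_mem hw hv))

theorem toSubmodule_adjoin_union
    (h : (S ∪ T).Pairwise fun x y => x * y ∈ Submodule.span K {x} ⊔ Submodule.span K {y}) :
    (Algebra.adjoin K (S ∪ T)).toSubmodule =
      (Algebra.adjoin K S).toSubmodule ⊔ (Algebra.adjoin K T).toSubmodule := by
  set M := (Algebra.adjoin K S).toSubmodule ⊔ (Algebra.adjoin K T).toSubmodule
  have absorb {U : Set A} (hU : U ⊆ S ∪ T) (hUM : (Algebra.adjoin K U).toSubmodule ≤ M) {x u : A}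
      (hx : x ∈ S ∪ T) (hu : u ∈ Algebra.adjoin K U) : x * u ∈ M := by
    by_cases hxU : x ∈ U
    · exact hUM ((Algebra.adjoin K U).mul_mem (Algebra.subset_adjoin hxU) hu)
    have hxM : Submodule.span K {x} ≤ M := (Submodule.span_singleton_le_iff_mem _ _).2 <|
      hx.elim (fun hx => Submodule.mem_sup_left (Algebra.subset_adjoin hx))
        (fun hx => Submodule.mem_sup_right (Algebra.subset_adjoin hx))
    exact sup_le hxM hUM (mul_mem_span_sup_adjoin
      (fun y hy => h hx (hU hy) (ne_of_mem_of_not_mem hy hxU).symm) hu)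
  have mul_mem' {u : A} (hu : u ∈ Algebra.adjoin K (S ∪ T)) : ∀ m ∈ M, u * m ∈ M := by
    induction hu using Algebra.adjoin_induction with
    | mem x hx =>
      intro m hm
      obtain ⟨a, ha, b, hb, rfl⟩ := Submodule.mem_sup.1 hm
      rw [mul_add]
      exact add_mem (absorb Set.subset_union_left le_sup_left hx ha)
        (absorb Set.subset_union_right le_sup_right hx hb)
    | algebraMap r => exact fun m hm => by simpa [Algebra.smul_def] using M.smul_mem r hm
    | add u v _ _ hu hv => exact fun m hm => by simpa [add_mul] using add_mem (hu m hm) (hv m hm)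
    | mul u v _ _ hu hv => exact fun m hm => by simpa [mul_assoc] using hu _ (hv m hm)
  refine le_antisymm (fun u hu => ?_) (sup_le
    (Algebra.adjoin_mono Set.subset_union_left) (Algebra.adjoin_mono Set.subset_union_right))
  exact mul_one u ▸ mul_mem' hu 1 (Submodule.mem_sup_left (one_mem (Algebra.adjoin K S)))

end Adjoin

theorem mem_of_mul_eq_one {K B : Type*} [CommRing K] [CommRing B] [Algebra K B]
    [Algebra.IsIntegral K B] {T : Subalgebra K B} {u w : B} (hw : w ∈ T) (h : u * w = 1) :
    u ∈ T := by
  have : Algebra.IsIntegral T B := .tower_top K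
  obtain ⟨w', hw'⟩ := (isUnit_of_map_unit (algebraMap T B) ⟨w, hw⟩
    (.of_mul_eq_one _ ((mul_comm _ _).trans h))).exists_right_inv
  have : u = w' := left_inv_eq_right_inv h (congr_arg Subtype.val hw')
  exact this ▸ w'.2

variable {K L : Type*} [Field K] [Field L] [Algebra K L] {t : L} {s : Set K}

/-- The `K`-subalgebra of `L` generated by the simple fractions `1 / (t - a)` with poles `a ∈ s`. -/
def poleRing (t : L) (s : Set K) : Subalgebra K L :=
  Algebra.adjoin K ((fun a => (t - algebraMap K L a)⁻¹) '' s)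

theorem inv_sub_mem_poleRing {a : K} (ha : a ∈ s) : (t - algebraMap K L a)⁻¹ ∈ poleRing t s :=
  Algebra.subset_adjoin ⟨a, ha, rfl⟩

theorem poleRing_mono {s' : Set K} (h : s ⊆ s') : poleRing t s ≤ poleRing t s' :=
  Algebra.adjoin_mono (Set.image_mono h)

/-- The inclusion `poleRing t s → poleRing t s'` for `s ⊆ s'`. -/
def poleInclusion {s' : Set K} (h : s ⊆ s') : poleRing t s →+* poleRing t s' :=
  (Subalgebra.inclusion (poleRing_mono h)).toRingHom

theorem poleRing_le_adjoin_simple : poleRing t s ≤ K⟮t⟯.toSubalgebra := by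
  refine Algebra.adjoin_le ?_
  rintro _ ⟨a, -, rfl⟩
  exact K⟮t⟯.inv_mem (sub_mem (IntermediateField.mem_adjoin_simple_self K t) (algebraMap_mem _ a))

theorem poleRing_le_adjoin_inv_sub (a : K) :
    poleRing t s ≤ K⟮(t - algebraMap K L a)⁻¹⟯.toSubalgebra := by
  refine poleRing_le_adjoin_simple.trans (IntermediateField.adjoin_simple_le_iff.2 ?_)
  have := inv_mem (IntermediateField.mem_adjoin_simple_self K (t - algebraMap K L a)⁻¹)
  simpa using add_mem this (algebraMap_mem _ a)

theorem isAlgebraic_mk {A : Subalgebra K L} {x d : A} (hA : A ≤ K⟮(x : L)⟯.toSubalgebra)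
    (hd : d ≠ 0) : IsAlgebraic K (Ideal.Quotient.mk (Ideal.span {d}) x) := by
  obtain ⟨P, Q, hPQ⟩ := IntermediateField.mem_adjoin_simple_iff K _ |>.1 (hA d.2)
  have hd' : (d : L) ≠ 0 := by simpa using hd
  have hQ : Polynomial.aeval (x : L) Q ≠ 0 := fun h => hd' (by rw [hPQ, h, div_zero])
  have hP : d * Polynomial.aeval x Q = Polynomial.aeval x P := by
    ext
    rw [eq_div_iff hQ] at hPQ
    simpa using hPQ
  refine ⟨P, ?_, ?_⟩
  · rintro rfl
    rw [map_zero, zero_div] at hPQ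
    exact hd' hPQ
  · rw [← Ideal.Quotient.mkₐ_eq_mk K, Polynomial.aeval_algHom_apply, ← hP,
      Ideal.Quotient.mkₐ_eq_mk,
      Ideal.Quotient.eq_zero_iff_mem]
    exact Ideal.mul_mem_right _ _ (Ideal.mem_span_singleton_self d)

theorem map_mem_of_forall_inv_sub {B : Type*} [CommRing B] [Algebra K B]
    (f : poleRing t s →ₐ[K] B) {T : Subalgebra K B}
    (h : ∀ a (ha : a ∈ s), f ⟨_, inv_sub_mem_poleRing ha⟩ ∈ T) (x : poleRing t s) : f x ∈ T := by
  have : poleRing t s ≤ (T.comap f).map (poleRing t s).val := by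
    refine Algebra.adjoin_le ?_
    rintro _ ⟨a, ha, rfl⟩
    exact ⟨⟨_, inv_sub_mem_poleRing ha⟩, h a ha, rfl⟩
  obtain ⟨y, hy, hxy⟩ := this x.2
  rwa [← Subtype.ext hxy]

theorem isIntegral_quotient_poleRing {d : poleRing t s} (hd : d ≠ 0) :
    Algebra.IsIntegral K (poleRing t s ⧸ Ideal.span {d}) := by
  refine ⟨fun x => ?_⟩
  obtain ⟨x, rfl⟩ := Ideal.Quotient.mk_surjective x
  refine map_mem_of_forall_inv_sub (Ideal.Quotient.mkₐ K (Ideal.span {d}))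
    (T := integralClosure K _) (fun a ha => ?_) x
  have := isAlgebraic_mk (x := ⟨_, inv_sub_mem_poleRing ha⟩) (poleRing_le_adjoin_inv_sub a) hd
  exact this.isIntegral

variable (ht : t ∉ (algebraMap K L).range)
include ht

theorem sub_algebraMap_ne_zero (a : K) : t - algebraMap K L a ≠ 0 :=
  fun h => ht ⟨a, (sub_eq_zero.1 h).symm⟩

theorem one_add_mul_one_sub_eq_one (a b : K) :
    (1 + (b - a) • (t - algebraMap K L b)⁻¹) * (1 - (b - a) • (t - algebraMap K L a)⁻¹) = 1 := by
  have ha := sub_algebraMap_ne_zero ht a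
  have hb := sub_algebraMap_ne_zero ht b
  rw [Algebra.smul_def, Algebra.smul_def, map_sub]
  field_simp
  ring

theorem toSubmodule_poleRing_union (s s' : Set K) :
    (poleRing t (s ∪ s')).toSubmodule =
      (poleRing t s).toSubmodule ⊔ (poleRing t s').toSubmodule := by
  rw [poleRing, Set.image_union, toSubmodule_adjoin_union, poleRing, poleRing]
  rw [← Set.image_union]
  rintro _ ⟨a, -, rfl⟩ _ ⟨b, -, rfl⟩ hab
  have ha := sub_algebraMap_ne_zero ht a
  have hb := sub_algebraMap_ne_zero ht b
  have hab : algebraMap K L a - algebraMap K L b ≠ 0 :=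
    sub_ne_zero.2 fun h => hab (by simp only [h])
  have hmem (x : L) (k : K) : k • x ∈ Submodule.span K {x} :=
    Submodule.smul_mem _ k (Submodule.mem_span_singleton_self x)
  refine Submodule.mem_sup.2 ⟨_, hmem _ (a - b)⁻¹, _, hmem _ (-(a - b)⁻¹), ?_⟩
  rw [neg_smul, ← sub_eq_add_neg, ← smul_sub, Algebra.smul_def, map_inv₀, map_sub]
  field_simp
  ring

theorem exists_poleInclusion_add_poleInclusion_eq {s s' : Set K} (x : poleRing t (s ∪ s')) :
    ∃ x₁ x₂, poleInclusion Set.subset_union_left x₁ +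
      poleInclusion Set.subset_union_right x₂ = x := by
  have hx : (x : L) ∈ (poleRing t (s ∪ s')).toSubmodule := x.2
  rw [toSubmodule_poleRing_union ht] at hx
  obtain ⟨x₁, h₁, x₂, h₂, h⟩ := Submodule.mem_sup.1 hx
  exact ⟨⟨x₁, h₁⟩, ⟨x₂, h₂⟩, Subtype.ext h⟩

theorem finite_quotient_poleRing (hs : s.Nonempty) {d : poleRing t s} (hd : d ≠ 0) :
    Module.Finite K (poleRing t s ⧸ Ideal.span {d}) := by
  obtain ⟨a, ha⟩ := hs
  let ζ (b : K) (hb : b ∈ s) : poleRing t s := ⟨_, inv_sub_mem_poleRing hb⟩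
  have hint := isIntegral_quotient_poleRing hd
  set B := poleRing t s ⧸ Ideal.span {d}
  let f : poleRing t s →ₐ[K] B := Ideal.Quotient.mkₐ K (Ideal.span {d})
  let T : Subalgebra K B := Algebra.adjoin K {f (ζ a ha)}
  have hT : T = ⊤ := by
    refine eq_top_iff.2 fun x _ => ?_
    obtain ⟨x, rfl⟩ := Ideal.Quotient.mk_surjective x
    refine map_mem_of_forall_inv_sub f (fun b hb => ?_) x
    -- Integrality over `K` puts the inverse of `1 - (b - a) / (t - a) = (t - b) / (t - a)` in `T`.
    have hw : 1 - (b - a) • f (ζ a ha) ∈ T :=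
      sub_mem (one_mem T) (T.smul_mem (Algebra.self_mem_adjoin_singleton K _) _)
    have huw : (1 + (b - a) • f (ζ b hb)) * (1 - (b - a) • f (ζ a ha)) = 1 := by
      have : (1 + (b - a) • ζ b hb) * (1 - (b - a) • ζ a ha) = 1 :=
        Subtype.ext (one_add_mul_one_sub_eq_one ht a b)
      simpa only [map_mul, map_add, map_sub, map_one, map_smul] using congr_arg f this
    have h1 := T.sub_mem (mem_of_mul_eq_one hw huw) (one_mem T)
    rcases eq_or_ne b a with rfl | hab
    · exact Algebra.self_mem_adjoin_singleton K _
    · rwa [add_sub_cancel_left, ← Subalgebra.mem_toSubmodule,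
        Submodule.smul_mem_iff _ (sub_ne_zero.2 hab)] at h1
  exact Algebra.IsIntegral.finite (h' := ⟨⟨{f (ζ a ha)}, by simpa using hT⟩⟩)

theorem exists_sub_mul_mem_of_poleRing (hs : s.Nonempty) {S : Subring (poleRing t s)⟦X⟧}
    (hC : ∀ r, C r ∈ S) (hS : ∀ h : K⟦X⟧, h.map (algebraMap K (poleRing t s)) ∈ S)
    {δ : (poleRing t s)⟦X⟧} (hδ : δ ≠ 0) (f : (poleRing t s)⟦X⟧) : ∃ g, f - g * δ ∈ S :=
  exists_sub_mul_mem hC hS (fun _ hd => finite_quotient_poleRing ht hs hd) hδ f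

end PoleRing

section Evaluation

theorem nonarchimedeanRing_of_valued (F Γ : Type*) [CommRing F]
    [LinearOrderedCommGroupWithZero Γ] [Valued F Γ] : NonarchimedeanRing F where
  is_nonarchimedean U hU := by
    obtain ⟨γ, hγ⟩ := Valued.mem_nhds_zero.1 hU
    exact ⟨⟨Valued.v.restrict.ltAddSubgroup γ, Valued.isOpen_ball F _⟩, hγ⟩

variable {F Γ R : Type*} [Field F] [LinearOrderedCommGroupWithZero Γ] [MulArchimedean Γ]
  [Valued F Γ] [CommRing R] {ι : R →+* F} {τ : F}

theorem tendsto_mul_pow_of_v_le_one {x : ℕ → F} (hx : ∀ n, Valued.v (x n) ≤ 1)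
    (hτ : Valued.v τ < 1) : Tendsto (fun n => x n * τ ^ n) atTop (𝓝 0) := by
  have hτ' := Valued.tendsto_zero_pow_of_v_lt_one hτ
  rw [(Valued.hasBasis_nhds_zero F Γ).tendsto_right_iff] at hτ' ⊢
  refine fun γ hγ => (hτ' γ hγ).mono fun n (hn : Valued.v.restrict (τ ^ n) < γ) => ?_
  change Valued.v.restrict (x n * τ ^ n) < γ
  rw [map_mul]
  exact (mul_le_of_le_one_left' (Valued.v.restrict_le_one_iff.2 (hx n))).trans_lt hn

theorem tendsto_sum_mul_pow_of_eq_add_mul {a u : ℕ → F} (hu : ∀ n, Valued.v (u n) ≤ 1)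
    (hτ : Valued.v τ < 1) (h : ∀ n, u n = a n + τ * u (n + 1)) :
    Tendsto (fun n => ∑ k ∈ range n, a k * τ ^ k) atTop (𝓝 (u 0)) := by
  have hsum (n) : ∑ k ∈ range n, a k * τ ^ k = u 0 - u n * τ ^ n := by
    induction n with
    | zero => simp
    | succ n ih => rw [sum_range_succ, ih, h n]; ring
  simp_rw [hsum]
  simpa using (tendsto_mul_pow_of_v_le_one hu hτ).const_sub (u 0)

variable [CompleteSpace F] (hι : ∀ r, Valued.v (ι r) ≤ 1) (hτ : Valued.v τ < 1)

include hι hτ in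
theorem summable_map_coeff_mul_pow (f : R⟦X⟧) : Summable fun n => ι (coeff n f) * τ ^ n := by
  have := nonarchimedeanRing_of_valued F Γ
  refine NonarchimedeanAddGroup.summable_of_tendsto_cofinite_zero ?_
  rw [Nat.cofinite_eq_atTop]
  exact tendsto_mul_pow_of_v_le_one (fun n => hι _) hτ

include hι hτ in
theorem tsum_map_coeff_mul_mul_pow (f g : R⟦X⟧) :
    ∑' n, ι (coeff n (f * g)) * τ ^ n =
      (∑' n, ι (coeff n f) * τ ^ n) * ∑' n, ι (coeff n g) * τ ^ n := by
  have := nonarchimedeanRing_of_valued F Γ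
  have hf := summable_map_coeff_mul_pow hι hτ f
  have hg := summable_map_coeff_mul_pow hι hτ g
  have hfg := hf.mul_of_nonarchimedean hg
  rw [hf.tsum_mul_tsum_eq_tsum_sum_antidiagonal hg hfg]
  refine tsum_congr fun n => ?_
  rw [coeff_mul, map_sum, sum_mul]
  refine sum_congr rfl fun k hk => ?_
  rw [map_mul, ← mem_antidiagonal.1 hk, pow_add]
  exact mul_mul_mul_comm _ _ _ _

/-- The evaluation `∑ rₙ Tⁿ ↦ ∑ ι(rₙ) τⁿ` of power series at a point `τ` of valuation less than
one in a complete valued field, the coefficients being mapped by `ι` into the valuation ring. -/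
def evalHom : R⟦X⟧ →+* F where
  toFun f := ∑' n, ι (coeff n f) * τ ^ n
  map_zero' := by simp
  map_one' := by
    rw [tsum_eq_single 0 fun n hn => by simp [coeff_one, hn]]
    simp
  map_add' f g := by
    simp_rw [map_add, add_mul]
    exact (summable_map_coeff_mul_pow hι hτ f).tsum_add (summable_map_coeff_mul_pow hι hτ g)
  map_mul' := tsum_map_coeff_mul_mul_pow hι hτ

theorem hasSum_evalHom (f : R⟦X⟧) :
    HasSum (fun n => ι (coeff n f) * τ ^ n) (evalHom hι hτ f) :=
  (summable_map_coeff_mul_pow hι hτ f).hasSum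

theorem evalHom_C (r : R) : evalHom hι hτ (C r) = ι r :=
  (tsum_eq_single 0 fun n hn => by simp [coeff_C, hn]).trans (by simp)

theorem evalHom_X : evalHom hι hτ X = τ :=
  (tsum_eq_single 1 fun n hn => by simp [coeff_X, hn]).trans (by simp)

theorem evalHom_map {S : Type*} [CommRing S] {ι' : S →+* F} (hι' : ∀ r, Valued.v (ι' r) ≤ 1)
    {σ : S →+* R} (hσ : ∀ r, ι (σ r) = ι' r) (f : S⟦X⟧) :
    evalHom hι hτ (f.map σ) = evalHom hι' hτ f :=
  tsum_congr fun n => by rw [coeff_map, hσ]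

theorem evalHom_mem {S : Subring F} (hS : IsClosed (S : Set F)) (hιS : ∀ r, ι r ∈ S) (hτS : τ ∈ S)
    (f : R⟦X⟧) : evalHom hι hτ f ∈ S :=
  tsum_mem hS fun n => S.mul_mem (hιS _) (S.pow_mem hτS n)

theorem v_evalHom_le_one (f : R⟦X⟧) : Valued.v (evalHom hι hτ f) ≤ 1 :=
  evalHom_mem hι hτ (S := Valued.v.integer) (Valued.isClosed_integer F) hι hτ.le f

theorem evalHom_C_add_X_mul (r : R) (g : R⟦X⟧) :
    evalHom hι hτ (C r + X * g) = ι r + τ * evalHom hι hτ g := by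
  rw [map_add, map_mul, evalHom_C, evalHom_X]

theorem X_dvd_of_v_evalHom_lt_one (hι' : ∀ r ≠ 0, Valued.v (ι r) = 1) {f : R⟦X⟧}
    (hf : Valued.v (evalHom hι hτ f) < 1) : X ∣ f := by
  rw [X_dvd_iff]
  by_contra h0
  rw [eq_X_mul_shift_add_const f, add_comm, evalHom_C_add_X_mul, Valuation.map_add_eq_of_lt_left,
    hι' _ h0] at hf
  · exact hf.ne rfl
  · rw [hι' _ h0, map_mul]
    exact (mul_le_of_le_one_right' (v_evalHom_le_one hι hτ _)).trans_lt hτ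

theorem evalHom_mk_eq {r : ℕ → R} {u : ℕ → F} (hu : ∀ n, Valued.v (u n) ≤ 1)
    (h : ∀ n, u n = ι (r n) + τ * u (n + 1)) : evalHom hι hτ (mk r) = u 0 := by
  have := (hasSum_evalHom hι hτ (mk r)).tendsto_sum_nat
  simp only [coeff_mk] at this
  exact tendsto_nhds_unique this (tendsto_sum_mul_pow_of_eq_add_mul hu hτ h)

theorem evalHom_eq_of_C_of_X {ψ : R⟦X⟧ →+* F} (hψ : ∀ f, Valued.v (ψ f) ≤ 1)
    (hC : ∀ r, ψ (C r) = ι r) (hX : ψ X = τ) : evalHom hι hτ = ψ := by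
  ext f
  have hstep (n : ℕ) : ψ (PowerSeries.mk fun k => coeff (n + k) f) =
      ι (coeff n f) + τ * ψ (PowerSeries.mk fun k => coeff (n + 1 + k) f) := by
    rw [eq_X_mul_shift_add_const (PowerSeries.mk fun k => coeff (n + k) f), map_add, map_mul, hX,
      hC, add_comm]
    simp [add_assoc, add_comm 1]
  have hf : (PowerSeries.mk fun n => coeff n f) = f := PowerSeries.ext fun n => coeff_mk n _
  simpa only [zero_add, hf] using evalHom_mk_eq hι hτ (fun n => hψ _) hstep

theorem exists_eq_add_mul_of_mem_closure (hι' : ∀ r ≠ 0, Valued.v (ι r) = 1) (hτ0 : τ ≠ 0) {x : F}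
    (hx : x ∈ closure ((evalHom hι hτ).range : Set F)) :
    ∃ r, ∃ y ∈ closure ((evalHom hι hτ).range : Set F), x = ι r + τ * y := by
  have isOpen_ball (a : F) : IsOpen {y | Valued.v (y - a) < 1} := by
    simpa [Set.preimage, Valuation.restrict_lt_one_iff] using
      (Valued.isOpen_ball F 1).preimage (continuous_sub_right a)
  obtain ⟨_, hf : Valued.v _ < 1, f, rfl⟩ :=
    mem_closure_iff.1 hx _ (isOpen_ball x) (show Valued.v (x - x) < 1 by simp)
  have hx' : Valued.v (x - ι (constantCoeff f)) < 1 := by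
    rw [← sub_add_sub_cancel x (evalHom hι hτ f)]
    refine Valuation.map_add_lt _ (by rwa [Valuation.map_sub_swap]) ?_
    nth_rw 1 [eq_X_mul_shift_add_const f]
    rw [add_comm, evalHom_C_add_X_mul, add_sub_cancel_left, map_mul]
    exact (mul_le_of_le_one_right' (v_evalHom_le_one hι hτ _)).trans_lt hτ
  refine ⟨constantCoeff f, (x - ι (constantCoeff f)) / τ, ?_, by field_simp; ring⟩
  refine map_mem_closure (f := fun y => (y - ι (constantCoeff f)) / τ) (by fun_prop)
    ((isOpen_ball _).inter_closure ⟨hx', hx⟩) ?_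
  rintro _ ⟨hg : Valued.v _ < 1, g, rfl⟩
  rw [← evalHom_C hι hτ, ← map_sub] at hg
  obtain ⟨h, hh⟩ := X_dvd_of_v_evalHom_lt_one hι hτ hι' hg
  refine ⟨h, ?_⟩
  change _ = (_ - _) / τ
  rw [← evalHom_C hι hτ, ← map_sub, hh, map_mul, evalHom_X, mul_div_cancel_left₀ _ hτ0]

theorem isClosed_range_evalHom (hι' : ∀ r ≠ 0, Valued.v (ι r) = 1) (hτ0 : τ ≠ 0) :
    IsClosed ((evalHom hι hτ).range : Set F) := by
  refine isClosed_of_closure_subset fun x hx => ?_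
  choose r y hy hxy using fun x : closure ((evalHom hι hτ).range : Set F) =>
    exists_eq_add_mul_of_mem_closure hι hτ hι' hτ0 x.2
  have hv (x : closure ((evalHom hι hτ).range : Set F)) : Valued.v x.1 ≤ 1 :=
    closure_minimal (Set.range_subset_iff.2 (v_evalHom_le_one hι hτ))
      (Valued.isClosed_integer F) x.2
  let u (n : ℕ) := (fun x => ⟨y x, hy x⟩)^[n] (⟨x, hx⟩ : closure ((evalHom hι hτ).range : Set F))
  have hu (n : ℕ) : (u n : F) = ι (r (u n)) + τ * u (n + 1) := by
    simp only [u, Function.iterate_succ_apply']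
    exact hxy _
  exact ⟨_, evalHom_mk_eq hι hτ (fun n => hv (u n)) hu⟩

end Evaluation

end Patching

namespace AnalyticPatching

open Matrix Patching
open scoped IntermediateField

section PolesOnLines

variable {K : Type*} [Field K]

theorem orderValuation_coe_of_isHomogeneous {p : MvPolynomial (Fin 2) K} {m : ℕ}
    (hp : p.IsHomogeneous m) (h0 : p ≠ 0) :
    orderValuation K (p : PS K) = WithZero.exp (-(m : ℤ)) := by
  have hp0 : (p : PS K) ≠ 0 := by simpa using h0
  have horder : (p : PS K).order = m := by
    obtain ⟨d, hd⟩ := MvPolynomial.ne_zero_iff.1 h0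
    refine MvPowerSeries.order_eq_nat.2 ⟨⟨d, by simpa using hd, ?_⟩, fun e he => ?_⟩
    · exact Finsupp.degree_eq_weight_one (R := ℕ) ▸ hp hd
    · rw [MvPolynomial.coeff_coe]
      exact hp.coeff_eq_zero he.ne
  rw [orderValuation_apply_of_ne_zero K hp0, horder, ENat.toNat_natCast]

theorem v_algebraMap (f : PS K) : v K (algebraMap (PS K) (E K) f) = orderValuation K f :=
  Valuation.extendToLocalization_apply_map_apply _ _ _ _

theorem v_algebraMap_le_one (f : PS K) : v K (algebraMap (PS K) (E K) f) ≤ 1 := by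
  rw [v_algebraMap]
  rcases eq_or_ne f 0 with rfl | hf
  · simp
  · rw [orderValuation_apply_of_ne_zero K hf, ← WithZero.exp_zero, WithZero.exp_le_exp]
    simp

theorem aeval_X_Y_eq_algebraMap (p : MvPolynomial (Fin 2) K) :
    MvPolynomial.aeval ![X K, Y K] p = algebraMap (PS K) (E K) p := by
  have : MvPolynomial.aeval ![X K, Y K] = (IsScalarTower.toAlgHom K (PS K) (E K)).comp
      (MvPolynomial.coeToMvPowerSeries.algHom K) := by
    ext i
    fin_cases i <;> simp [X, Y]
  simpa using congr($this p)

theorem v_aeval_X_Y_of_isHomogeneous {p : MvPolynomial (Fin 2) K} {m : ℕ}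
    (hp : p.IsHomogeneous m) (h0 : p ≠ 0) :
    v K (MvPolynomial.aeval ![X K, Y K] p) = WithZero.exp (-(m : ℤ)) := by
  rw [aeval_X_Y_eq_algebraMap, v_algebraMap, orderValuation_coe_of_isHomogeneous hp h0]

theorem v_Y : v K (Y K) = WithZero.exp (-1) := by
  simpa using v_aeval_X_Y_of_isHomogeneous (MvPolynomial.isHomogeneous_X K 1)
    (MvPolynomial.X_ne_zero 1)

theorem Y_ne_zero : Y K ≠ 0 :=
  (v K).ne_zero_iff.1 (v_Y (K := K) ▸ WithZero.exp_ne_zero)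

theorem v_aeval_X_div_Y {P : Polynomial K} (hP : P ≠ 0) :
    v K (Polynomial.aeval (X K / Y K) P) = 1 := by
  have h := v_aeval_X_Y_of_isHomogeneous (P.isHomogeneous_homogenize (n := P.natDegree))
    (mt (Polynomial.homogenize_eq_zero_iff le_rfl).1 hP)
  rw [MvPolynomial.aeval_def, MvPolynomial.eval₂_eq_eval_map, ← Polynomial.homogenize_map,
    Polynomial.eval_homogenize Polynomial.natDegree_map_le _ Y_ne_zero,
    Polynomial.eval_map_algebraMap, map_mul, map_pow] at h
  refine mul_right_cancel₀ (pow_ne_zero P.natDegree ((v K).ne_zero_iff.2 (Y_ne_zero (K := K)))) ?_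
  refine h.trans ?_
  rw [v_Y, one_mul, ← WithZero.exp_nsmul, nsmul_eq_mul, mul_neg_one]

theorem v_eq_one_of_mem_adjoin {f : E K} (hf : f ∈ K⟮X K / Y K⟯) (hf0 : f ≠ 0) : v K f = 1 := by
  obtain ⟨P, Q, rfl⟩ := (IntermediateField.mem_adjoin_simple_iff K f).1 hf
  have hP : P ≠ 0 := by
    rintro rfl
    simp at hf0
  have hQ : Q ≠ 0 := by
    rintro rfl
    simp at hf0
  rw [map_div₀, v_aeval_X_div_Y hP, v_aeval_X_div_Y hQ, div_one]

theorem X_div_Y_notMem_range : X K / Y K ∉ (algebraMap K (E K)).range := by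
  rintro ⟨a, ha⟩
  have h := v_aeval_X_div_Y (Polynomial.X_sub_C_ne_zero a)
  rw [map_sub, Polynomial.aeval_X, Polynomial.aeval_C, ha, sub_self, map_zero] at h
  exact zero_ne_one h

theorem X_sub_mul_Y_eq (a : K) :
    X K - algebraMap K (E K) a * Y K = Y K * (X K / Y K - algebraMap K (E K) a) := by
  rw [mul_sub, mul_div_cancel₀ _ Y_ne_zero, mul_comm (Y K)]

theorem v_X_sub_mul_Y (a : K) : v K (X K - algebraMap K (E K) a * Y K) = WithZero.exp (-1) := by
  have h := v_aeval_X_div_Y (Polynomial.X_sub_C_ne_zero a)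
  rw [map_sub, Polynomial.aeval_X, Polynomial.aeval_C] at h
  rw [X_sub_mul_Y_eq, map_mul, h, v_Y, mul_one]

theorem v_eq_one_of_mem_poleRing {s : Set K} {f : E K} (hf : f ∈ poleRing (X K / Y K) s)
    (hf0 : f ≠ 0) : v K f = 1 :=
  v_eq_one_of_mem_adjoin (poleRing_le_adjoin_simple hf) hf0

theorem v_toEHat (f : E K) : Valued.v (toEHat K f) = v K f :=
  Valued.valuedCompletion_apply (K := WithVal (v K)) (WithVal.toVal (v K) f)

/-- The embedding in the completion of the ring of polynomials in the fractions
`1 / (X/Y - a) = Y / (X - aY)`, for `a ∈ s`. -/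
def poleEmb (s : Set K) : poleRing (X K / Y K) s →+* EHat K :=
  (toEHat K).comp (algebraMap _ (E K))

theorem v_poleEmb {s : Set K} {r : poleRing (X K / Y K) s} (hr : r ≠ 0) :
    Valued.v (poleEmb s r) = 1 :=
  (v_toEHat _).trans (v_eq_one_of_mem_poleRing r.2 (by simpa using hr))

theorem v_poleEmb_le_one {s : Set K} (r : poleRing (X K / Y K) s) :
    Valued.v (poleEmb s r) ≤ 1 := by
  rcases eq_or_ne r 0 with rfl | hr
  · simp
  · exact (v_poleEmb hr).le

theorem v_toEHat_X_sub_mul_Y_lt_one (a : K) :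
    Valued.v (toEHat K (X K - algebraMap K (E K) a * Y K)) < 1 := by
  rw [v_toEHat, v_X_sub_mul_Y, ← WithZero.exp_zero, WithZero.exp_lt_exp]
  simp

/-- The homomorphism `∑ rₙ Tⁿ ↦ ∑ rₙ (X - aY)ⁿ` by which the rings `D_J` are described as rings of
power series in one variable. -/
def evalLine (a : K) (s : Set K) : PowerSeries (poleRing (X K / Y K) s) →+* EHat K :=
  evalHom v_poleEmb_le_one (v_toEHat_X_sub_mul_Y_lt_one a)

theorem evalLine_C (a : K) {s : Set K} (r : poleRing (X K / Y K) s) :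
    evalLine a s (PowerSeries.C r) = toEHat K r :=
  evalHom_C _ _ r

theorem evalLine_X (a : K) (s : Set K) :
    evalLine a s PowerSeries.X = toEHat K (X K - algebraMap K (E K) a * Y K) :=
  evalHom_X _ _

theorem evalLine_comp_map_poleInclusion (a : K) {s s' : Set K} (h : s ⊆ s') :
    (evalLine a s').comp (PowerSeries.map (poleInclusion h)) = evalLine a s := by
  ext f
  rw [RingHom.comp_apply]
  exact evalHom_map _ _ _ (fun _ => rfl) f

theorem isClosed_range_evalLine (a : K) (s : Set K) :
    IsClosed ((evalLine a s).range : Set (EHat K)) := by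
  refine isClosed_range_evalHom _ _ (fun r hr => v_poleEmb hr) ((map_ne_zero (toEHat K)).2 ?_)
  exact (v K).ne_zero_iff.1 (v_X_sub_mul_Y a ▸ WithZero.exp_ne_zero)

theorem evalLine_map_algebraMap_mem_range (a : K) (s : Set K) (h : PowerSeries K) :
    evalLine a s (h.map (algebraMap K _)) ∈ (toEHat K).range := by
  let ℓ : PS K := MvPowerSeries.X 0 - MvPowerSeries.C a * MvPowerSeries.X 1
  have hℓ : PowerSeries.HasSubst ℓ := .of_constantCoeff_zero (by simp [ℓ])
  let ψ : PowerSeries K →+* EHat K := (toEHat K).comp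
    ((algebraMap (PS K) (E K)).comp (PowerSeries.substAlgHom hℓ : PowerSeries K →ₐ[K] PS K))
  have hψ : evalHom (ι := (poleEmb s).comp (algebraMap K _)) (fun r => v_poleEmb_le_one _)
      (v_toEHat_X_sub_mul_Y_lt_one a) = ψ := by
    refine evalHom_eq_of_C_of_X _ _ (fun f => ?_) (fun r => ?_) ?_
    · exact (v_toEHat _).trans_le (v_algebraMap_le_one _)
    · have : (PowerSeries.substAlgHom hℓ : PowerSeries K →ₐ[K] PS K) (PowerSeries.C r) =
          algebraMap K (PS K) r := AlgHom.commutes _ r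
      rw [RingHom.comp_apply, RingHom.comp_apply, RingHom.coe_coe, this,
        ← IsScalarTower.algebraMap_apply]
      rfl
    · have : (PowerSeries.substAlgHom hℓ : PowerSeries K →ₐ[K] PS K) PowerSeries.X = ℓ := by
        rw [PowerSeries.coe_substAlgHom, PowerSeries.subst_X hℓ]
      rw [RingHom.comp_apply, RingHom.comp_apply, RingHom.coe_coe, this, map_sub, map_mul]
      rfl
  exact ⟨_, (congr($hψ h).symm.trans (evalHom_map _ _ _ (fun _ => rfl) h).symm)⟩

theorem exists_evalLine_sub_mul_mem_range (a : K) {s : Set K} (hs : s.Nonempty)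
    {δ : PowerSeries (poleRing (X K / Y K) s)} (hδ : δ ≠ 0)
    (f : PowerSeries (poleRing (X K / Y K) s)) :
    ∃ g, evalLine a s (f - g * δ) ∈ (toEHat K).range := by
  have hC (r) : PowerSeries.C r ∈ (toEHat K).range.comap (evalLine a s) :=
    ⟨r, (evalLine_C a r).symm⟩
  have hK (h : PowerSeries K) : h.map (algebraMap K _) ∈ (toEHat K).range.comap (evalLine a s) :=
    evalLine_map_algebraMap_mem_range a s h
  exact exists_sub_mul_mem_of_poleRing (K := K) X_div_Y_notMem_range hs hC hK hδ f

theorem exists_eq_map_mul_map_evalLine (a : K) {s s' : Set K} (hs : (s ∪ s').Nonempty)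
    {ι : Type*} [Fintype ι] [DecidableEq ι] {b : GL ι (EHat K)}
    (hb : ∀ k l, b k l ∈ Subfield.closure (Set.range (evalLine a (s ∪ s')))) :
    ∃ (x : GL ι (E K)) (P₁ : GL ι (PowerSeries (poleRing (X K / Y K) s)))
      (P₂ : GL ι (PowerSeries (poleRing (X K / Y K) s'))),
      b = x.map (toEHat K) * P₁.map (evalLine a s) * P₂.map (evalLine a s') := by
  obtain ⟨x, H, hH, rfl⟩ := exists_eq_map_mul_map_of_forall_mem_closure
    (ε := toEHat K) (fun _ hδ f => exists_evalLine_sub_mul_mem_range a hs hδ f) hb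
  obtain ⟨P₁, P₂, rfl⟩ := exists_eq_map_mul_map
    (exists_poleInclusion_add_poleInclusion_eq (K := K) X_div_Y_notMem_range) hH
  refine ⟨x, P₁, P₂, ?_⟩
  rw [map_mul, mul_assoc, ← GeneralLinearGroup.map_comp_apply,
    ← GeneralLinearGroup.map_comp_apply, ← GeneralLinearGroup.map_comp,
    ← GeneralLinearGroup.map_comp, evalLine_comp_map_poleInclusion,
    evalLine_comp_map_poleInclusion]

end PolesOnLines

section Rings
variable {K : Type*} [Field K] {I : Type*} (c : I → K)

theorem z_eq_inv (i : I) : z c i = (X K / Y K - algebraMap K (E K) (c i))⁻¹ := by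
  rw [z, X_sub_mul_Y_eq, ← div_div, div_self Y_ne_zero, one_div]

theorem z_mul_X_sub_mul_Y (i : I) : z c i * (X K - algebraMap K (E K) (c i) * Y K) = Y K :=
  div_mul_cancel₀ _ ((v K).ne_zero_iff.1 (v_X_sub_mul_Y (c i) ▸ WithZero.exp_ne_zero))

theorem poleRing_image_eq_adjoin (J : Set I) :
    poleRing (X K / Y K) (c '' J) = Algebra.adjoin K (z c '' J) := by
  simp only [poleRing, Set.image_image, z_eq_inv]

theorem evalLine_mem_D (a : K) {J : Set I} (f : PowerSeries (poleRing (X K / Y K) (c '' J))) :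
    evalLine a (c '' J) f ∈ D c J := by
  have hmem {x : E K} (hx : x ∈ polyRing c J) : toEHat K x ∈ D c J :=
    Subring.le_topologicalClosure _ ⟨x, hx, rfl⟩
  refine evalHom_mem _ _ (Subring.isClosed_topologicalClosure _) (fun r => hmem ?_) (hmem ?_) f
  · exact Algebra.adjoin_mono Set.subset_union_left (poleRing_image_eq_adjoin c J ▸ r.2)
  · exact sub_mem (Algebra.subset_adjoin (by simp))
      (mul_mem (algebraMap_mem _ _) (Algebra.subset_adjoin (by simp)))

theorem D_le_range_evalLine {J : Set I} {i : I} (hi : i ∈ J) :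
    D c J ≤ (evalLine (c i) (c '' J)).range := by
  refine Subring.topologicalClosure_minimal _ ?_ (isClosed_range_evalLine _ _)
  have hz {j : I} (hj : j ∈ J) : z c j ∈ poleRing (X K / Y K) (c '' J) :=
    poleRing_image_eq_adjoin c J ▸ Algebra.subset_adjoin ⟨j, hj, rfl⟩
  have hY : toEHat K (Y K) ∈ (evalLine (c i) (c '' J)).range :=
    ⟨PowerSeries.C ⟨z c i, hz hi⟩ * PowerSeries.X, by
      rw [map_mul, evalLine_C, evalLine_X, ← map_mul, z_mul_X_sub_mul_Y]⟩
  let S : Subalgebra K (E K) :=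
    { (evalLine (c i) (c '' J)).range.comap (toEHat K) with
      algebraMap_mem' := fun r => ⟨PowerSeries.C (algebraMap K _ r), evalLine_C _ _⟩ }
  suffices polyRing c J ≤ S from Subring.map_le_iff_le_comap.2 this
  refine Algebra.adjoin_le ?_
  rintro _ (⟨j, hj, rfl⟩ | rfl | rfl)
  · exact ⟨PowerSeries.C ⟨z c j, hz hj⟩, evalLine_C _ _⟩
  · rw [← sub_add_cancel (X K) (algebraMap K (E K) (c i) * Y K)]
    exact S.add_mem ⟨PowerSeries.X, evalLine_X _ _⟩ (S.mul_mem (S.algebraMap_mem _) hY)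
  · exact hY

theorem D_mono {J J' : Set I} (h : J ⊆ J') : D c J ≤ D c J' :=
  closure_mono (Set.image_mono (Algebra.adjoin_mono
    (Set.union_subset_union_left _ (Set.image_mono h))))

theorem D_singleton_le_Qi' (i : I) : D c {i} ≤ Qi' c i := by
  refine le_inf (fun x hx => Subfield.subset_closure (D_mono c (Set.subset_univ _) hx)) ?_
  refine le_iInf₂ fun j hj => (D_mono c ?_).trans le_sup_right
  exact Set.singleton_subset_iff.2 (Ne.symm hj)

theorem mem_closure_range_evalLine (i : I) {x : EHat K} (hx : x ∈ Q c) :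
    x ∈ Subfield.closure (Set.range (evalLine (c i) (c '' {i}ᶜ ∪ c '' {i}))) := by
  rw [← Set.image_union, Set.compl_union_self]
  exact Subfield.closure_mono (D_le_range_evalLine c (Set.mem_univ i)) hx

end Rings

end AnalyticPatching

end

open AnalyticPatching Matrix in
theorem proposition1p14_general {K : Type*} [Field K] {I : Type*} (c : I → K) (i : I)
    {ι : Type*} [Fintype ι] [DecidableEq ι] (b : GL ι (Q c)) :
    ∃ (b₁ : GL ι (Qi c i)) (b₂ : GL ι (Qi' c i)),
      b.map (Q c).subtype = b₁.map (Qi c i).subtype * b₂.map (Qi' c i).subtype := by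
  obtain ⟨x, P₁, P₂, h⟩ := exists_eq_map_mul_map_evalLine (c i)
    (s := c '' {i}ᶜ) (s' := c '' {i}) ⟨c i, .inr ⟨i, rfl, rfl⟩⟩
    (b := b.map (Q c).subtype) fun k l => mem_closure_range_evalLine c i (b k l).2
  let ε : E K →+* Qi c i := (toEHat K).codRestrict _ fun f =>
    le_sup_left (a := (toEHat K).range) ⟨f, rfl⟩
  let φ₁ := (evalLine (c i) (c '' {i}ᶜ)).codRestrict (Qi c i) fun f =>
    le_sup_right (a := (toEHat K).range) (evalLine_mem_D c (c i) f)
  let φ₂ := (evalLine (c i) (c '' {i})).codRestrict (Qi' c i) fun f =>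
    D_singleton_le_Qi' c i (evalLine_mem_D c (c i) f)
  refine ⟨x.map ε * P₁.map φ₁, P₂.map φ₂, ?_⟩
  rw [h, map_mul]
  rfl

theorem proposition1p14 {K : Type*} [Field K] [Infinite K] {I : Type*} [Finite I] (c : I → K)
    (hc : Function.Injective c) (i : I) (n : ℕ)
    (b : Matrix.GeneralLinearGroup (Fin n) (AnalyticPatching.Q c)) :
    ∃ (b₁ : Matrix.GeneralLinearGroup (Fin n) (AnalyticPatching.Qi c i))
      (b₂ : Matrix.GeneralLinearGroup (Fin n) (AnalyticPatching.Qi' c i)),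
      Matrix.GeneralLinearGroup.map (AnalyticPatching.Q c).subtype b =
        Matrix.GeneralLinearGroup.map (AnalyticPatching.Qi c i).subtype b₁ *
          Matrix.GeneralLinearGroup.map (AnalyticPatching.Qi' c i).subtype b₂ :=
  proposition1p14_general c i b
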